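/- Let $\mathbb{H}$ be the quaternions with Euclidean modulus $|\cdot|$, $\mathbb{B}=\{q\in\mathbb{H}:|q|<1\}$ and $\mathbb{S}=\{I\in\mathbb{H}: I^2=-1\}$. A function $f:\mathbb{B}\to\mathbb{H}$ is slice regular if for every $I\in\mathbb{S}$ its restriction $f_I$ to $\mathbb{B}\cap(\mathbb{R}+\mathbb{R}I)$ has continuous partial derivatives and satisfies $\frac12\left(\frac{\partial}{\partial x}+I\frac{\partial}{\partial y}\right)f_I(x+yI)=0$; its slice derivative $f'$ is given by $f'(x+yI)=\frac12\left(\frac{\partial}{\partial x}-I\frac{\partial}{\partial y}\right)f_I(x+yI)$. A slice regular function $h$ on $\mathbb{B}$ with $h(0)=0$, $h'(0)=1$ and no zero in $\mathbb{B}$ other than $0$ is slice starlike if $\operatorname{Re}\left(h(q)^{-1}q\,h'(q)\right)>0$ for all $q\in\mathbb{B}\setminus\{0\}$. A slice regular function $f$ on $\mathbb{B}$ with $f(0)=0$, $f'(0)=1$ is slice close-to-convex if there is a slice starlike function $h$ with $\operatorname{Re}\left(h(q)^{-1}q f'(q)\right)>0$ for all $q\in\mathbb{B}\setminus\{0\}$.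 Theorem 1.3. If $f(q)=q+\sum_{k\ge 2}q^kp_k$, with $p_k\in\mathbb{H}$, is slice close-to-convex on $\mathbb{B}$, then $$|q|+\sum_{k=2}^{\infty}|q^kp_k|\le 1\qquad\text{for all } |q|\le \frac{3-\sqrt5}{2}$$ (in particular the series converges). The constant $(3-\sqrt5)/2$ cannot be improved: there is a slice close-to-convex function $f(q)=q+\sum_{k\ge2}q^kp_k$ on $\mathbb{B}$ such that $|q|+\sum_{k=2}^{\infty}|q^kp_k|>1$ (with a convergent series) for every $q$ with $\frac{3-\sqrt5}{2}<|q|<1$. -/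

import Mathlib

open scoped Quaternion

noncomputable section

namespace SliceRegular

/-- The `2`-sphere `𝕊` of imaginary units of the quaternions. -/
def imaginaryUnits : Set ℍ[ℝ] := {I | I ^ 2 = -1}

/-- The open unit ball `𝔹` of the quaternions (the norm is the Euclidean one). -/
def unitBall : Set ℍ[ℝ] := Metric.ball 0 1

/-- The point `x + y I` of the plane `ℂ_I`. -/
def slicePoint (I : ℍ[ℝ]) (x y : ℝ) : ℍ[ℝ] := (x : ℍ[ℝ]) + (y : ℍ[ℝ]) * I

/-- `∂f_I / ∂x` at `x + y I`. -/
def partialX (I : ℍ[ℝ]) (f : ℍ[ℝ] → ℍ[ℝ]) (x y : ℝ) : ℍ[ℝ] :=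
  deriv (fun t : ℝ => f (slicePoint I t y)) x

/-- `∂f_I / ∂y` at `x + y I`. -/
def partialY (I : ℍ[ℝ]) (f : ℍ[ℝ] → ℍ[ℝ]) (x y : ℝ) : ℍ[ℝ] :=
  deriv (fun t : ℝ => f (slicePoint I x t)) y

/-- (Left) slice regularity on an open set `Ω`: for every imaginary unit `I` the restriction `f_I`
of `f` to `Ω ∩ ℂ_I` is continuously differentiable in the real coordinates `x, y` and satisfies
`(1/2) (∂/∂x + I ∂/∂y) f_I = 0`. Only the values of `f` on `Ω` matter. -/
def IsSliceRegularOn (f : ℍ[ℝ] → ℍ[ℝ]) (Ω : Set ℍ[ℝ]) : Prop :=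
  ∀ I ∈ imaginaryUnits,
    ContDiffOn ℝ 1 (fun z : ℂ => f (slicePoint I z.re z.im)) {z : ℂ | slicePoint I z.re z.im ∈ Ω} ∧
    ∀ x y : ℝ, slicePoint I x y ∈ Ω →
      (1 / 2 : ℝ) • (partialX I f x y + I * partialY I f x y) = 0

/-- The `I`-derivative `(1/2) (∂/∂x - I ∂/∂y) f_I` at `x + y I`. -/
def sliceDerivAlong (I : ℍ[ℝ]) (f : ℍ[ℝ] → ℍ[ℝ]) (x y : ℝ) : ℍ[ℝ] :=
  (1 / 2 : ℝ) • (partialX I f x y - I * partialY I f x y)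

/-- The standard imaginary unit `i`. -/
def unitI : ℍ[ℝ] := ⟨0, 1, 0, 0⟩

open Classical in
/-- An imaginary unit `I` such that `q ∈ ℂ_I`: it is `Im q / |Im q|` if `q` is not real. If `q` is
real, any unit would do, and we take `i`. -/
def imUnit (q : ℍ[ℝ]) : ℍ[ℝ] :=
  if q.im = 0 then unitI else ‖q.im‖⁻¹ • q.im

/-- The slice derivative `f'`, the function equal to the `I`-derivative of `f` on each `ℂ_I`.
The point is written as `q = x + y I` with `x = Re q`, `y = |Im q|`; that the choice of `I` and `y`
is immaterial is `sliceDeriv_slicePoint`. -/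
def sliceDeriv (f : ℍ[ℝ] → ℍ[ℝ]) (q : ℍ[ℝ]) : ℍ[ℝ] :=
  sliceDerivAlong (imUnit q) f q.re ‖q.im‖

/-- The class `𝓢`: slice regular on `𝔹`, `f(0) = 0`, `f'(0) = 1`, and `0` is the only zero in
`𝔹`. -/
structure IsClassS (f : ℍ[ℝ] → ℍ[ℝ]) : Prop where
  regular : IsSliceRegularOn f unitBall
  map_zero : f 0 = 0
  deriv_zero : sliceDeriv f 0 = 1
  zeros : ∀ q ∈ unitBall, f q = 0 → q = 0

/-- Slice starlike functions: `f ∈ 𝓢` with `Re (f(q)⁻¹ q f'(q)) > 0` on `𝔹`. At the removable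
singularity `q = 0` the expression extends by the value `1`, so the condition is imposed at the
other points. -/
structure IsSliceStarlike (f : ℍ[ℝ] → ℍ[ℝ]) : Prop extends IsClassS f where
  re_pos : ∀ q ∈ unitBall, q ≠ 0 → 0 < ((f q)⁻¹ * q * sliceDeriv f q).re

/-- Slice close-to-convex functions: `f` is slice regular on `𝔹` with `f(0) = 0`, `f'(0) = 1`, and
there is a slice starlike `h` with `Re (h(q)⁻¹ q f'(q)) > 0` on `𝔹`. At the removable singularity
`q = 0` the expression extends by the value `1`, so the condition is imposed at the other
points. -/
structure IsSliceCloseToConvex (f : ℍ[ℝ] → ℍ[ℝ]) : Prop where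
  regular : IsSliceRegularOn f unitBall
  map_zero : f 0 = 0
  deriv_zero : sliceDeriv f 0 = 1
  exists_starlike : ∃ h : ℍ[ℝ] → ℍ[ℝ], IsSliceStarlike h ∧
    ∀ q ∈ unitBall, q ≠ 0 → 0 < ((h q)⁻¹ * q * sliceDeriv f q).re

/-- `f(q) = q + ∑_{k ≥ 2} q^k p_k` on `𝔹`. The entries `p 0` and `p 1` are not used. -/
def HasNormalizedExpansion (f : ℍ[ℝ] → ℍ[ℝ]) (p : ℕ → ℍ[ℝ]) : Prop :=
  ∀ q ∈ unitBall, HasSum (fun k : ℕ => q ^ (k + 2) * p (k + 2)) (f q - q)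

theorem imUnit_mem (q : ℍ[ℝ]) : imUnit q ∈ imaginaryUnits := by
  unfold imUnit imaginaryUnits
  split_ifs with h
  · change unitI ^ 2 = -1
    have h0 : unitI.re = 0 := rfl
    have h1 : unitI.imI = 1 := rfl
    have h2 : unitI.imJ = 0 := rfl
    have h3 : unitI.imK = 0 := rfl
    rw [pow_two]
    ext <;> simp [h0, h1, h2, h3]
  · have hn : ‖q.im‖ ≠ 0 := norm_ne_zero_iff.mpr h
    have h2 : q.im * q.im = -((‖q.im‖ ^ 2 : ℝ) : ℍ[ℝ]) := by
      have := Quaternion.self_mul_star q.im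
      rw [Quaternion.normSq_eq_norm_mul_self] at this
      rw [pow_two, ← this]
      simp
    change (‖q.im‖⁻¹ • q.im) ^ 2 = -1
    simp only [pow_two, smul_mul_smul_comm, h2]
    rw [← Quaternion.coe_one, smul_neg, Quaternion.smul_coe]
    congr 2
    field_simp

theorem norm_eq_one_of_mem {I : ℍ[ℝ]} (hI : I ∈ imaginaryUnits) : ‖I‖ = 1 := by
  have h : ‖I ^ 2‖ = 1 := by rw [show I ^ 2 = -1 from hI]; simp
  rw [norm_pow] at h
  exact (pow_eq_one_iff_of_nonneg (norm_nonneg _) two_ne_zero).mp h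

theorem re_eq_zero_of_mem {I : ℍ[ℝ]} (hI : I ∈ imaginaryUnits) : I.re = 0 := by
  have h : I * I = -1 := by rw [← pow_two]; exact hI
  have h0 := congrArg QuaternionAlgebra.re h
  have h1 := congrArg QuaternionAlgebra.imI h
  have h2 := congrArg QuaternionAlgebra.imJ h
  have h3 := congrArg QuaternionAlgebra.imK h
  simp at h0 h1 h2 h3
  by_contra hr
  have e1 : I.imI = 0 := by
    apply (mul_right_inj' hr).mp; linarith
  have e2 : I.imJ = 0 := by
    apply (mul_right_inj' hr).mp; linarith
  have e3 : I.imK = 0 := by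
    apply (mul_right_inj' hr).mp; linarith
  rw [e1, e2, e3] at h0
  nlinarith [sq_nonneg I.re]

/-- The slice derivative of a slice regular function is its `I`-derivative on each `ℂ_I`. -/
theorem sliceDeriv_slicePoint {f : ℍ[ℝ] → ℍ[ℝ]} {Ω : Set ℍ[ℝ]} (hf : IsSliceRegularOn f Ω)
    {I : ℍ[ℝ]} (hI : I ∈ imaginaryUnits) {x y : ℝ} (hq : slicePoint I x y ∈ Ω) :
    sliceDeriv f (slicePoint I x y) = sliceDerivAlong I f x y := by
  have hre : (slicePoint I x y).re = x := by
    simp [slicePoint, re_eq_zero_of_mem hI]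
  have him : (slicePoint I x y).im = y • I := by
    have h0 := re_eq_zero_of_mem hI
    ext <;> simp [slicePoint, h0]
  have hnorm : ‖(slicePoint I x y).im‖ = |y| := by
    rw [him, norm_smul, norm_eq_one_of_mem hI, mul_one, Real.norm_eq_abs]
  have hI0 : I ≠ 0 := by
    rintro rfl
    simpa using norm_eq_one_of_mem hI
  unfold sliceDeriv
  rw [hre, hnorm]
  rcases lt_trichotomy y 0 with hy | rfl | hy
  · have hu : imUnit (slicePoint I x y) = -I := by
      have : ¬ (slicePoint I x y).im = 0 := by
        rw [him]; exact smul_ne_zero hy.ne hI0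
      rw [imUnit, if_neg this, hnorm, him, smul_smul, abs_of_neg hy, inv_neg, neg_mul,
        inv_mul_cancel₀ hy.ne, neg_smul, one_smul]
    rw [hu, abs_of_neg hy]
    have hX : partialX (-I) f x (-y) = partialX I f x y := by
      simp [partialX, slicePoint]
    have hY : partialY (-I) f x (-y) = -partialY I f x y := by
      have := deriv_comp_neg (fun t : ℝ => f (slicePoint I x t)) (-y)
      rw [neg_neg] at this
      rw [partialY, partialY, ← this]
      congr 1
      funext t
      simp [slicePoint]
    simp [sliceDerivAlong, hX, hY]
  · have key : ∀ J ∈ imaginaryUnits,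
        sliceDerivAlong J f x 0 = deriv (fun t : ℝ => f (t : ℍ[ℝ])) x := by
      intro J hJ
      have hmem : slicePoint J x 0 ∈ Ω := by simpa [slicePoint] using hq
      have h := (hf J hJ).2 x 0 hmem
      have h' : J * partialY J f x 0 = -partialX J f x 0 := by
        rw [smul_eq_zero] at h
        rcases h with h | h
        · norm_num at h
        · exact (neg_eq_of_add_eq_zero_right h).symm
      rw [sliceDerivAlong, h', sub_neg_eq_add, ← two_smul ℝ, smul_smul]
      norm_num [partialX, slicePoint]
    rw [abs_zero, key _ (imUnit_mem _), key _ hI]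
  · have hu : imUnit (slicePoint I x y) = I := by
      have : ¬ (slicePoint I x y).im = 0 := by
        rw [him]; exact smul_ne_zero hy.ne' hI0
      rw [imUnit, if_neg this, hnorm, him, smul_smul, abs_of_pos hy,
        inv_mul_cancel₀ hy.ne', one_smul]
    rw [hu, abs_of_pos hy]

end SliceRegular

end

/-! Write `f(q) = q B(q)` and `h(q) = q A(q)` with power series `A`, `B` whose coefficients stand on
the right, and let `D` have the coefficients `(n + 1) b_n`, so that `f' = D`. Off the origin the
hypothesis reads `Re (A(q)⁻¹ D(q)) > 0`. The pointwise quotient is not a power series, but the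
quotient `P` with `A * P = D` for the Cauchy product is one. Its value at `q` is the pointwise
quotient at a conjugate of `q`, hence again of positive real part (`exists_regularQuotient`).
Carathéodory's theorem, reduced to `ℂ` by projecting onto a slice, bounds the coefficients `c_n`, `n
≥ 1`, of `P` by `2` (`norm_coeff_le_two_of_re_pos`). Comparing coefficients in `A * P = D` gives `(n
+ 1) b_n = ∑_{i < n} a_i c_{n-i} + a_n`. For `f = h` induction yields `|a_n| ≤ n + 1`; inserting
this for general `f` yields `|b_n| ≤ n + 1`, that is `|p_k| ≤ k`. The sum in question is therefore
at most `r / (1 - r)²` with `r = |q|`, and for `r < 1` this is at most `1` exactly when `r² - 3r + 1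
≥ 0`, i.e. `r ≤ (3 - √5)/2`. The Koebe function `q / (1 - q)²` is slice starlike and has `p_k = k`,
so it attains equality in every coefficient bound and the radius is sharp. -/

namespace PowerSeries

/-! ### Power series with right coefficients over a normed division ring -/

section NormedDivisionRing

variable {R : Type*} [NormedDivisionRing R]

/-- The power series converges absolutely at every point of the open unit ball. -/
def ConvergesOnUnitBall (A : PowerSeries R) : Prop :=
  ∀ r : ℝ, 0 ≤ r → r < 1 → Summable fun n => ‖coeff n A‖ * r ^ n

/-- The sum of `∑ q ^ n * a n`: the coefficients stand on the right. -/
noncomputable def leftEval (A : PowerSeries R) (q : R) : R := ∑' n, q ^ n * coeff n A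

theorem ConvergesOnUnitBall.summable_norm {A : PowerSeries R} (hA : A.ConvergesOnUnitBall) {q : R}
    (hq : ‖q‖ < 1) : Summable fun n => ‖q ^ n * coeff n A‖ := by
  simpa [norm_mul, norm_pow, mul_comm] using hA ‖q‖ (norm_nonneg q) hq

theorem ConvergesOnUnitBall.hasSum [CompleteSpace R] {A : PowerSeries R}
    (hA : A.ConvergesOnUnitBall) {q : R} (hq : ‖q‖ < 1) :
    HasSum (fun n => q ^ n * coeff n A) (A.leftEval q) :=
  (hA.summable_norm hq).of_norm.hasSum

theorem leftEval_eq {A : PowerSeries R} {q s : R} (h : HasSum (fun n => q ^ n * coeff n A) s) :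
    A.leftEval q = s := h.tsum_eq

theorem leftEval_zero (A : PowerSeries R) : A.leftEval 0 = coeff 0 A := by
  rw [leftEval, tsum_eq_single 0]
  · simp
  · intro n hn; simp [hn]

/-- Abel's lemma: convergence at a real point `s` with `r < s < 1` bounds the terms there, and a
geometric series of ratio `r / s` dominates at radius `r`. -/
theorem convergesOnUnitBall_of_summable [NormedAlgebra ℝ R] {A : PowerSeries R}
    (h : ∀ q : R, ‖q‖ < 1 → Summable fun n => q ^ n * coeff n A) : A.ConvergesOnUnitBall := by
  intro r hr hr1
  obtain ⟨s, hrs, hs1⟩ := exists_between hr1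
  have hs0 : 0 < s := hr.trans_lt hrs
  have hns : ‖algebraMap ℝ R s‖ = s := by rw [norm_algebraMap', Real.norm_of_nonneg hs0.le]
  have ht := (h (algebraMap ℝ R s) (by rwa [hns])).tendsto_atTop_zero.norm
  obtain ⟨C, hC⟩ := ht.bddAbove_range
  have hC' : ∀ n, ‖coeff n A‖ * s ^ n ≤ C := by
    intro n
    have := hC ⟨n, rfl⟩
    simpa [norm_mul, norm_pow, hns, mul_comm] using this
  refine Summable.of_nonneg_of_le (fun n => by positivity) (fun n => ?_)
    ((summable_geometric_of_lt_one (div_nonneg hr hs0.le) ((div_lt_one hs0).mpr hrs)).mul_left C)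
  rw [div_pow]
  calc ‖coeff n A‖ * r ^ n = ‖coeff n A‖ * s ^ n * (r ^ n / s ^ n) := by
        field_simp
    _ ≤ C * (r ^ n / s ^ n) := by gcongr; exact hC' n

theorem ConvergesOnUnitBall.mul {A B : PowerSeries R} (hA : A.ConvergesOnUnitBall)
    (hB : B.ConvergesOnUnitBall) : (A * B).ConvergesOnUnitBall := by
  intro r hr hr1
  have hA' := hA r hr hr1
  have hB' := hB r hr hr1
  have key := summable_norm_sum_mul_antidiagonal_of_summable_norm hA'.norm hB'.norm
  refine Summable.of_nonneg_of_le (fun n => by positivity) (fun n => ?_) key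
  rw [coeff_mul]
  refine le_trans ?_ (le_abs_self _)
  refine (mul_le_mul_of_nonneg_right (norm_sum_le _ _) (by positivity)).trans ?_
  rw [Finset.sum_mul]
  refine Finset.sum_le_sum fun p hp => le_of_eq ?_
  rw [← Finset.HasAntidiagonal.mem_antidiagonal.mp hp, pow_add, norm_mul]
  ring

/-- One absolutely convergent double series is summed in two ways: along antidiagonals it is the
Cauchy product, along rows the powers of `q` enclose the value of `A`. That value need not commute
with `q`, so the right side does not split into a product in general. -/
theorem leftEval_mul [CompleteSpace R] {A B : PowerSeries R} (hA : A.ConvergesOnUnitBall)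
    (hB : B.ConvergesOnUnitBall) {q : R} (hq : ‖q‖ < 1) :
    (A * B).leftEval q = ∑' j, q ^ j * A.leftEval q * coeff j B := by
  -- The index of `B` comes first, so that the inner sum of `tsum_prod` runs over the coefficients
  -- of `A`.
  set F : ℕ × ℕ → R := fun p => q ^ (p.1 + p.2) * (coeff p.2 A * coeff p.1 B) with hF
  have hFs : Summable F := by
    refine Summable.of_norm ?_
    refine ((hB.summable_norm hq).mul_of_nonneg (hA.summable_norm hq) (fun _ => norm_nonneg _)
      (fun _ => norm_nonneg _)).congr fun p => ?_
    simp only [hF, norm_mul, norm_pow, pow_add]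
    ring
  have h1 : ∑' p, F p = ∑' j, q ^ j * A.leftEval q * coeff j B := by
    rw [hFs.tsum_prod]
    refine tsum_congr fun j => ?_
    rw [leftEval, ← tsum_mul_left, ← tsum_mul_right]
    refine tsum_congr fun i => ?_
    simp only [hF, pow_add, mul_assoc]
  have h2 : ∑' p, F p = (A * B).leftEval q := by
    have hs := (Finset.HasAntidiagonal.sigmaAntidiagonalEquivProd (A := ℕ)).summable_iff.mpr hFs
    rw [← (Finset.HasAntidiagonal.sigmaAntidiagonalEquivProd (A := ℕ)).tsum_eq F]
    refine (Summable.tsum_sigma' (fun n => (hasSum_fintype _).summable) hs).trans ?_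
    refine tsum_congr fun n => ?_
    refine (tsum_fintype _).trans ?_
    refine (Finset.sum_coe_sort (Finset.HasAntidiagonal.antidiagonal n) F).trans ?_
    rw [coeff_mul, Finset.mul_sum, ← Finset.Nat.sum_antidiagonal_swap]
    refine Finset.sum_congr rfl fun p hp => ?_
    rw [← Finset.HasAntidiagonal.mem_antidiagonal.mp hp]
    simp [hF, add_comm]
  rw [← h2, h1]

theorem leftEval_mul_of_commute [CompleteSpace R] {A B : PowerSeries R}
    (hA : A.ConvergesOnUnitBall) (hB : B.ConvergesOnUnitBall) {q : R} (hq : ‖q‖ < 1)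
    (hc : Commute q (A.leftEval q)) : (A * B).leftEval q = A.leftEval q * B.leftEval q := by
  rw [leftEval_mul hA hB hq, leftEval.eq_1 B, ← tsum_mul_left]
  exact tsum_congr fun j => by rw [(hc.pow_left j).eq, mul_assoc]

/-- The star product evaluates at `q` as the product of the value of the first factor at `q` with
the value of the second at a conjugate of `q`. -/
theorem leftEval_mul_of_ne_zero [CompleteSpace R] {A B : PowerSeries R}
    (hA : A.ConvergesOnUnitBall) (hB : B.ConvergesOnUnitBall) {q : R} (hq : ‖q‖ < 1)
    (h0 : A.leftEval q ≠ 0) : (A * B).leftEval q =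
      A.leftEval q * B.leftEval ((A.leftEval q)⁻¹ * q * A.leftEval q) := by
  rw [leftEval_mul hA hB hq, leftEval.eq_1 B, ← tsum_mul_left]
  refine tsum_congr fun j => ?_
  have : ((A.leftEval q)⁻¹ * q * A.leftEval q) ^ j = (A.leftEval q)⁻¹ * q ^ j * A.leftEval q := by
    induction j with
    | zero => simp [h0]
    | succ j ih => rw [pow_succ, ih, pow_succ]; simp only [mul_assoc, mul_inv_cancel_left₀ h0]
  rw [this]
  simp only [mul_assoc, mul_inv_cancel_left₀ h0]

end NormedDivisionRing

end PowerSeries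

/-- A vector-valued power series in a real variable is determined by its sum near `0`. -/
theorem eq_of_hasSum_pow_smul {E : Type*} [NormedAddCommGroup E] [NormedSpace ℝ E] {a b : ℕ → E}
    {s : ℝ → E} (ha : ∀ t : ℝ, |t| < 1 → HasSum (fun n => t ^ n • a n) (s t))
    (hb : ∀ t : ℝ, |t| < 1 → HasSum (fun n => t ^ n • b n) (s t)) : a = b := by
  let F : (ℕ → E) → FormalMultilinearSeries ℝ ℝ E := fun c n =>
    ContinuousMultilinearMap.mkPiRing ℝ (Fin n) (c n)
  have hF : ∀ c n, (F c).coeff n = c n := fun c n => by simp [F, FormalMultilinearSeries.coeff]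
  have key : ∀ c : ℕ → E, (∀ t : ℝ, |t| < 1 → HasSum (fun n => t ^ n • c n) (s t)) →
      HasFPowerSeriesAt s (F c) (0 : ℝ) := by
    intro c hc
    refine hasFPowerSeriesAt_iff.mpr ?_
    filter_upwards [Metric.ball_mem_nhds (0 : ℝ) one_pos] with t ht
    rw [zero_add]
    simpa [hF] using hc t (by simpa using ht)
  have h := (key a ha).eq_formalMultilinearSeries (key b hb)
  funext n
  rw [← hF a, ← hF b, h]

/-! ### Slices and the power series of a slice regular function -/

namespace SliceRegular

/-- The embedding of `ℂ` onto the slice `ℂ_I`. -/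
noncomputable def sliceHom {I : ℍ[ℝ]} (hI : I ∈ imaginaryUnits) : ℂ →ₐ[ℝ] ℍ[ℝ] :=
  Complex.lift ⟨I, by rw [← pow_two]; exact hI⟩

theorem slicePoint_eq_sliceHom {I : ℍ[ℝ]} (hI : I ∈ imaginaryUnits) (z : ℂ) :
    slicePoint I z.re z.im = sliceHom hI z := by
  rw [sliceHom, Complex.lift_apply, Complex.liftAux_apply, slicePoint,
    Quaternion.coe_mul_eq_smul]
  rfl

theorem sliceHom_ofReal {I : ℍ[ℝ]} (hI : I ∈ imaginaryUnits) (t : ℝ) :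
    sliceHom hI (t : ℂ) = (t : ℍ[ℝ]) := by
  rw [← slicePoint_eq_sliceHom]; simp [slicePoint]

theorem sliceHom_I {I : ℍ[ℝ]} (hI : I ∈ imaginaryUnits) : sliceHom hI Complex.I = I := by
  rw [← slicePoint_eq_sliceHom]; simp [slicePoint]

theorem star_eq_neg_of_mem {I : ℍ[ℝ]} (hI : I ∈ imaginaryUnits) : star I = -I := by
  have h := re_eq_zero_of_mem hI
  ext <;> simp [h]

theorem star_sliceHom {I : ℍ[ℝ]} (hI : I ∈ imaginaryUnits) (z : ℂ) :
    star (sliceHom hI z) = sliceHom hI (star z) := by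
  simp only [← slicePoint_eq_sliceHom, slicePoint]
  simp [star_eq_neg_of_mem hI, Quaternion.coe_mul_eq_smul]

theorem norm_sliceHom {I : ℍ[ℝ]} (hI : I ∈ imaginaryUnits) (z : ℂ) :
    ‖sliceHom hI z‖ = ‖z‖ := by
  have h1 : ((‖sliceHom hI z‖ * ‖sliceHom hI z‖ : ℝ) : ℍ[ℝ]) = ((‖z‖ * ‖z‖ : ℝ) : ℍ[ℝ]) := by
    rw [← Quaternion.normSq_eq_norm_mul_self, ← Quaternion.self_mul_star, star_sliceHom, ← map_mul,
      Complex.star_def, Complex.mul_conj, sliceHom_ofReal, Complex.normSq_eq_norm_sq, pow_two]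
  exact (mul_self_inj (norm_nonneg _) (norm_nonneg _)).mp (Quaternion.coe_injective h1)

theorem sliceHom_re_add_norm_im (q : ℍ[ℝ]) :
    sliceHom (imUnit_mem q) ⟨q.re, ‖q.im‖⟩ = q := by
  rw [← slicePoint_eq_sliceHom, slicePoint, Quaternion.coe_mul_eq_smul, imUnit]
  split_ifs with h
  · conv_rhs => rw [← Quaternion.re_add_im q]
    simp [h]
  · conv_rhs => rw [← Quaternion.re_add_im q]
    simp [smul_smul, mul_inv_cancel₀ (norm_ne_zero_iff.mpr h)]

theorem exists_eq_sliceHom (q : ℍ[ℝ]) :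
    ∃ (I : ℍ[ℝ]) (hI : I ∈ imaginaryUnits) (z : ℂ), sliceHom hI z = q :=
  ⟨_, imUnit_mem q, _, sliceHom_re_add_norm_im q⟩

theorem setOf_slicePoint_mem_unitBall {I : ℍ[ℝ]} (hI : I ∈ imaginaryUnits) :
    {z : ℂ | slicePoint I z.re z.im ∈ unitBall} = Metric.ball 0 1 := by
  ext z
  rw [Set.mem_ofPred_eq, slicePoint_eq_sliceHom hI, unitBall, mem_ball_zero_iff, mem_ball_zero_iff,
    norm_sliceHom]

theorem mem_unitBall {q : ℍ[ℝ]} : q ∈ unitBall ↔ ‖q‖ < 1 := mem_ball_zero_iff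

/-- The complex structure on `ℍ` given by left multiplication with `I`. -/
@[reducible] noncomputable def sliceNormedSpace {I : ℍ[ℝ]} (hI : I ∈ imaginaryUnits) :
    NormedSpace ℂ ℍ[ℝ] :=
  { Module.compHom ℍ[ℝ] (sliceHom hI).toRingHom with
    norm_smul_le := fun z q => by
      change ‖sliceHom hI z * q‖ ≤ _
      rw [norm_mul, norm_sliceHom] }

theorem hasDerivAt_complexMk_left (x y : ℝ) :
    HasDerivAt (fun t : ℝ => (⟨t, y⟩ : ℂ)) 1 x := by
  have h : (fun t : ℝ => (⟨t, y⟩ : ℂ)) = fun t : ℝ => (t : ℂ) + y * Complex.I := by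
    funext t; apply Complex.ext <;> simp
  rw [h]
  exact (Complex.ofRealCLM.hasDerivAt (x := x)).add_const _

theorem hasDerivAt_complexMk_right (x y : ℝ) :
    HasDerivAt (fun t : ℝ => (⟨x, t⟩ : ℂ)) Complex.I y := by
  have h : (fun t : ℝ => (⟨x, t⟩ : ℂ)) = fun t : ℝ => (x : ℂ) + t * Complex.I := by
    funext t; apply Complex.ext <;> simp
  rw [h]
  simpa using ((Complex.ofRealCLM.hasDerivAt (x := y)).mul_const Complex.I).const_add (x : ℂ)

/-- On each slice, a slice regular function and its slice derivative are given by a power series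
and its term-by-term derivative. -/
theorem IsSliceRegularOn.exists_hasSum_slice {f : ℍ[ℝ] → ℍ[ℝ]} (hf : IsSliceRegularOn f unitBall)
    {I : ℍ[ℝ]} (hI : I ∈ imaginaryUnits) : ∃ a : ℕ → ℍ[ℝ], ∀ z : ℂ, ‖z‖ < 1 →
      HasSum (fun n => sliceHom hI z ^ n * a n) (f (sliceHom hI z)) ∧
      HasSum (fun n : ℕ => sliceHom hI z ^ n * (((n : ℝ) + 1) • a (n + 1)))
        (sliceDeriv f (sliceHom hI z)) := by
  -- For left multiplication by `ℂ_I` the slice equation is the Cauchy–Riemann equation, so the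
  -- restriction is a holomorphic map into a complex Banach space and equals its Taylor series.
  let _ : NormedSpace ℂ ℍ[ℝ] := sliceNormedSpace hI
  have hsm : ∀ (z : ℂ) (q : ℍ[ℝ]), z • q = sliceHom hI z * q := fun _ _ => rfl
  have hst : IsScalarTower ℝ ℂ ℍ[ℝ] := ⟨fun r z q => by
    rw [hsm, hsm, map_smul, smul_mul_assoc]⟩
  set g : ℂ → ℍ[ℝ] := fun z => f (sliceHom hI z) with hg
  have hg' : g = fun z : ℂ => f (slicePoint I z.re z.im) := by
    funext z; rw [slicePoint_eq_sliceHom hI]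
  have hball : ∀ z : ℂ, ‖z‖ < 1 → Metric.ball (0 : ℂ) 1 ∈ nhds z := fun z hz =>
    Metric.isOpen_ball.mem_nhds (by simpa using hz)
  have hreal : ∀ z : ℂ, ‖z‖ < 1 → DifferentiableAt ℝ g z := by
    intro z hz
    have h := (hf I hI).1
    rw [setOf_slicePoint_mem_unitBall hI, ← hg'] at h
    exact (h.contDiffAt (hball z hz)).differentiableAt one_ne_zero
  have hX : ∀ z : ℂ, ‖z‖ < 1 → partialX I f z.re z.im = fderiv ℝ g z 1 := by
    intro z hz
    have := (hreal z hz).hasFDerivAt.comp_hasDerivAt_of_eq z.re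
      (hasDerivAt_complexMk_left z.re z.im) rfl
    rw [← this.deriv, hg']; rfl
  have hY : ∀ z : ℂ, ‖z‖ < 1 → partialY I f z.re z.im = fderiv ℝ g z Complex.I := by
    intro z hz
    have := (hreal z hz).hasFDerivAt.comp_hasDerivAt_of_eq z.im
      (hasDerivAt_complexMk_right z.re z.im) rfl
    rw [← this.deriv, hg']; rfl
  have hII : I * I = -1 := by rw [← pow_two]; exact hI
  have hCR : ∀ z : ℂ, ‖z‖ < 1 → fderiv ℝ g z Complex.I = I * fderiv ℝ g z 1 := by
    intro z hz
    have hz' : slicePoint I z.re z.im ∈ unitBall := by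
      rw [slicePoint_eq_sliceHom hI, mem_unitBall, norm_sliceHom]; exact hz
    have h := (hf I hI).2 z.re z.im hz'
    rw [hX z hz, hY z hz, smul_eq_zero_iff_right (by norm_num)] at h
    have h2 : I * (fderiv ℝ g z 1 + I * fderiv ℝ g z Complex.I) = 0 := by rw [h, mul_zero]
    rw [mul_add, ← mul_assoc, hII, neg_one_mul, add_neg_eq_zero] at h2
    exact h2.symm
  have hdiff : ∀ z : ℂ, ‖z‖ < 1 → HasDerivAt g (fderiv ℝ g z 1) z := by
    intro z hz
    refine hasFDerivAt_of_restrictScalars ℝ (hreal z hz).hasFDerivAt ?_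
    refine ContinuousLinearMap.ext fun w => ?_
    have hw : w = w.re • (1 : ℂ) + w.im • Complex.I := by apply Complex.ext <;> simp
    conv_rhs => rw [hw, map_add, map_smul, map_smul, hCR z hz]
    change w • fderiv ℝ g z 1 = _
    rw [hsm, ← slicePoint_eq_sliceHom, slicePoint, Quaternion.coe_mul_eq_smul, add_mul,
      Quaternion.coe_mul_eq_smul, smul_mul_assoc]
  have hderiv : ∀ z : ℂ, ‖z‖ < 1 → sliceDeriv f (sliceHom hI z) = deriv g z := by
    intro z hz
    have hz' : slicePoint I z.re z.im ∈ unitBall := by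
      rw [slicePoint_eq_sliceHom hI, mem_unitBall, norm_sliceHom]; exact hz
    rw [← slicePoint_eq_sliceHom, sliceDeriv_slicePoint hf hI hz', sliceDerivAlong, hX z hz,
      hY z hz, hCR z hz, ← mul_assoc, hII, neg_one_mul, sub_neg_eq_add, ← two_smul ℝ, smul_smul,
      (hdiff z hz).deriv]
    norm_num
  have hon : DifferentiableOn ℂ g (Metric.ball 0 1) := fun z hz =>
    (hdiff z (by simpa using hz)).differentiableAt.differentiableWithinAt
  have hnat : ∀ (n : ℕ) (z : ℂ) (q : ℍ[ℝ]), ((n : ℂ))⁻¹ • z • q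
      = sliceHom hI z * ((n : ℝ)⁻¹ • q) := by
    intro n z q
    have : ((n : ℂ))⁻¹ = (((n : ℝ)⁻¹ : ℝ) : ℂ) := by push_cast; rfl
    rw [hsm, hsm, this, sliceHom_ofReal, Quaternion.coe_mul_eq_smul, mul_smul_comm]
  refine ⟨fun n => ((n.factorial : ℝ))⁻¹ • iteratedDeriv n g 0, fun z hz => ⟨?_, ?_⟩⟩
  · have h := Complex.hasSum_taylorSeries_on_ball hon (z := z) (by simpa using hz)
    simpa only [hnat, sub_zero, map_pow] using h
  · have h := Complex.hasSum_taylorSeries_on_ball (hon.deriv Metric.isOpen_ball) (z := z)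
      (by simpa using hz)
    rw [hderiv z hz]
    have hfac : ∀ n : ℕ, ((n : ℝ) + 1) * (((n + 1).factorial : ℝ))⁻¹ = ((n.factorial : ℝ))⁻¹ := by
      intro n
      rw [Nat.factorial_succ]
      push_cast
      field_simp
    simpa only [hnat, sub_zero, map_pow, smul_smul, hfac, iteratedDeriv_succ'] using h

open PowerSeries in
/-- A slice regular function on the unit ball and its slice derivative are given by a power series
and its term-by-term derivative. -/
theorem IsSliceRegularOn.exists_powerSeries {f : ℍ[ℝ] → ℍ[ℝ]}
    (hf : IsSliceRegularOn f unitBall) : ∃ A : PowerSeries ℍ[ℝ], ∀ q : ℍ[ℝ], ‖q‖ < 1 →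
      HasSum (fun n => q ^ n * coeff n A) (f q) ∧
      HasSum (fun n : ℕ => q ^ n * (((n : ℝ) + 1) • coeff (n + 1) A)) (sliceDeriv f q) := by
  obtain ⟨a, ha⟩ := hf.exists_hasSum_slice (imUnit_mem 0)
  have hreal : ∀ {I : ℍ[ℝ]} (hI : I ∈ imaginaryUnits) (b : ℕ → ℍ[ℝ]),
      (∀ z : ℂ, ‖z‖ < 1 → HasSum (fun n => sliceHom hI z ^ n * b n) (f (sliceHom hI z))) →
      ∀ t : ℝ, |t| < 1 → HasSum (fun n => t ^ n • b n) (f (t : ℍ[ℝ])) := by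
    intro I hI b hb t ht
    have h := hb t (by simpa using ht)
    rw [sliceHom_ofReal] at h
    simpa only [← Quaternion.coe_pow, Quaternion.coe_mul_eq_smul] using h
  refine ⟨PowerSeries.mk a, fun q hq => ?_⟩
  obtain ⟨I, hI, z, rfl⟩ := exists_eq_sliceHom q
  obtain ⟨b, hb⟩ := hf.exists_hasSum_slice hI
  -- All slices share the real axis, where the expansions must agree; hence the coefficients do not
  -- depend on `I`.
  have hab : a = b := eq_of_hasSum_pow_smul (hreal _ a fun z hz => (ha z hz).1)
    (hreal hI b fun z hz => (hb z hz).1)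
  subst hab
  simpa only [coeff_mk] using hb z (by rwa [norm_sliceHom] at hq)

end SliceRegular

/-! ### Complex power series and Carathéodory's coefficient bound -/

namespace PowerSeries

theorem ConvergesOnUnitBall.hasFPowerSeriesOnBall {A : PowerSeries ℂ}
    (hA : A.ConvergesOnUnitBall) :
    HasFPowerSeriesOnBall A.leftEval (FormalMultilinearSeries.ofScalars ℂ fun n => coeff n A)
      0 1 where
  r_le := by
    refine ENNReal.le_of_forall_nnreal_lt fun r hr => ?_
    refine FormalMultilinearSeries.le_radius_of_summable _ ?_
    simpa [FormalMultilinearSeries.ofScalars_norm] using hA r r.2 (by exact_mod_cast hr)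
  r_pos := one_pos
  hasSum := by
    intro y hy
    have hy' : ‖y‖ < 1 := by simpa [← ENNReal.coe_one, enorm_lt_coe, ← NNReal.coe_lt_coe] using hy
    rw [zero_add]
    simpa [FormalMultilinearSeries.ofScalars_apply_eq, mul_comm] using hA.hasSum hy'

theorem ConvergesOnUnitBall.differentiableOn_leftEval {A : PowerSeries ℂ}
    (hA : A.ConvergesOnUnitBall) : DifferentiableOn ℂ A.leftEval (Metric.ball 0 1) := by
  have h := hA.hasFPowerSeriesOnBall.differentiableOn
  rwa [← ENNReal.ofReal_one, Metric.eball_ofReal] at h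

theorem eq_of_leftEval_ofReal_eq {A B : PowerSeries ℂ} (hA : A.ConvergesOnUnitBall)
    (hB : B.ConvergesOnUnitBall) (h : ∀ t : ℝ, |t| < 1 → A.leftEval t = B.leftEval t) :
    A = B := by
  ext n
  refine congrFun (eq_of_hasSum_pow_smul (a := fun n => coeff n A) (b := fun n => coeff n B)
    (s := fun t => A.leftEval t) (fun t ht => ?_) (fun t ht => ?_)) n
  · simpa using hA.hasSum (q := (t : ℂ)) (by simpa using ht)
  · simpa [h t ht] using hB.hasSum (q := (t : ℂ)) (by simpa using ht)

theorem convergesOnUnitBall_one {R : Type*} [NormedDivisionRing R] :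
    (1 : PowerSeries R).ConvergesOnUnitBall := by
  intro r _ _
  refine summable_of_ne_finset_zero (s := {0}) fun n hn => ?_
  rw [coeff_one, if_neg (by simpa using hn)]
  simp

theorem leftEval_one {R : Type*} [NormedDivisionRing R] (q : R) :
    (1 : PowerSeries R).leftEval q = 1 := by
  rw [leftEval, tsum_eq_single 0]
  · simp
  · intro n hn; simp [coeff_one, hn]

/-- A power series without zeros in the unit disc has an inverse converging there. -/
theorem ConvergesOnUnitBall.exists_mul_eq_one {A : PowerSeries ℂ} (hA : A.ConvergesOnUnitBall)
    (h0 : ∀ z : ℂ, ‖z‖ < 1 → A.leftEval z ≠ 0) :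
    ∃ B : PowerSeries ℂ, B.ConvergesOnUnitBall ∧ A * B = 1 := by
  have hd : DifferentiableOn ℂ (fun z => (A.leftEval z)⁻¹) (Metric.ball 0 1) :=
    hA.differentiableOn_leftEval.inv fun z hz => h0 z (by simpa using hz)
  have hs : ∀ z : ℂ, ‖z‖ < 1 → HasSum (fun n => z ^ n * coeff n (PowerSeries.mk fun n =>
      ((n.factorial : ℂ))⁻¹ * iteratedDeriv n (fun z => (A.leftEval z)⁻¹) 0))
      (A.leftEval z)⁻¹ := by
    intro z hz
    have h := Complex.hasSum_taylorSeries_on_ball hd (z := z) (by simpa using hz)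
    simpa [mul_left_comm] using h
  have hB := convergesOnUnitBall_of_summable fun z hz => (hs z hz).summable
  refine ⟨_, hB, eq_of_leftEval_ofReal_eq (hA.mul hB) convergesOnUnitBall_one fun t ht => ?_⟩
  have ht' : ‖(t : ℂ)‖ < 1 := by simpa using ht
  rw [leftEval_mul_of_commute hA hB ht' (mul_comm _ _), leftEval_eq (hs t ht'), leftEval_one,
    mul_inv_cancel₀ (h0 t ht')]

/-- `1 - A` vanishes at `0` and has real part below `1`, so Borel–Carathéodory bounds it by `2|t| /
(1 - |t|)`. Dividing by `|t|` and letting `t → 0` bounds the derivative at `0`. -/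
theorem ConvergesOnUnitBall.norm_coeff_one_le {A : PowerSeries ℂ} (hA : A.ConvergesOnUnitBall)
    (h0 : coeff 0 A = 1) (hre : ∀ z : ℂ, ‖z‖ < 1 → 0 < (A.leftEval z).re) :
    ‖coeff 1 A‖ ≤ 2 := by
  have hd : HasDerivAt (fun z => 1 - A.leftEval z) (-coeff 1 A) 0 := by
    have h := hA.hasFPowerSeriesOnBall.hasFPowerSeriesAt.hasDerivAt.const_sub 1
    simpa [FormalMultilinearSeries.coeff_ofScalars] using h
  have hs := hd.tendsto_slope_zero.norm
  have hb : Filter.Tendsto (fun t : ℂ => 2 / (1 - ‖t‖)) (nhdsWithin 0 {0}ᶜ) (nhds 2) := by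
    have : ContinuousAt (fun t : ℂ => 2 / (1 - ‖t‖)) 0 := by
      refine ContinuousAt.div (by fun_prop) (by fun_prop) (by simp)
    have h := this.tendsto
    simp only [norm_zero, sub_zero, div_one] at h
    exact h.mono_left nhdsWithin_le_nhds
  rw [← norm_neg]
  refine le_of_tendsto_of_tendsto hs hb ?_
  have hball : Metric.ball (0 : ℂ) 1 ∈ nhdsWithin (0 : ℂ) {0}ᶜ :=
    mem_nhdsWithin_of_mem_nhds (Metric.ball_mem_nhds 0 one_pos)
  filter_upwards [hball, self_mem_nhdsWithin] with t ht ht0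
  have hbc := Complex.borelCaratheodory_zero (f := fun z => 1 - A.leftEval z) (M := 1) (R := 1)
    one_pos (hA.differentiableOn_leftEval.const_sub 1)
    (fun z hz => by
      have := hre z (by simpa using hz)
      simp only [Set.mem_ofPred_eq, Complex.sub_re, Complex.one_re]
      linarith) one_pos ht (by simp [leftEval_zero, h0])
  have htn : 0 < ‖t‖ := norm_pos_iff.mpr ht0
  rw [zero_add, leftEval_zero, h0, sub_self, sub_zero, norm_smul, norm_inv]
  rw [inv_mul_le_iff₀ htn]
  refine hbc.trans (le_of_eq ?_)
  ring

/-- Averaging over the rotations by the `n`-th roots of unity keeps the coefficients whose index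
is a multiple of `n`. -/
theorem ConvergesOnUnitBall.hasSum_coeff_mul {A : PowerSeries ℂ} (hA : A.ConvergesOnUnitBall)
    {n : ℕ} (hn : n ≠ 0) {ω : ℂ} (hω : IsPrimitiveRoot ω n) {z : ℂ} (hz : ‖z‖ < 1) :
    HasSum (fun k => (z ^ n) ^ k * coeff (n * k) A)
      ((n : ℂ)⁻¹ * ∑ j ∈ Finset.range n, A.leftEval (ω ^ j * z)) := by
  have hω1 : ‖ω‖ = 1 := hω.norm'_eq_one hn
  have h := (hasSum_sum (s := Finset.range n) fun j _ => hA.hasSum (q := ω ^ j * z)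
    (by simpa [hω1] using hz)).mul_left (n : ℂ)⁻¹
  have hinj : Function.Injective fun k : ℕ => n * k := mul_right_injective₀ hn
  have hnC : (n : ℂ) ≠ 0 := by exact_mod_cast hn
  have hterm : ∀ k, ∑ j ∈ Finset.range n, (ω ^ j * z) ^ k * coeff k A =
      (∑ j ∈ Finset.range n, (ω ^ k) ^ j) * (z ^ k * coeff k A) := by
    intro k
    rw [Finset.sum_mul]
    refine Finset.sum_congr rfl fun j _ => ?_
    rw [mul_pow, ← pow_mul, ← pow_mul, mul_comm j k, mul_assoc]
  simp only [hterm] at h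
  rw [← hinj.hasSum_iff] at h
  · have heq : ∀ k : ℕ, (n : ℂ)⁻¹ * ((∑ j ∈ Finset.range n, (ω ^ (n * k)) ^ j) *
        (z ^ (n * k) * coeff (n * k) A)) = (z ^ n) ^ k * coeff (n * k) A := by
      intro k
      have : ω ^ (n * k) = 1 := by rw [pow_mul, hω.pow_eq_one, one_pow]
      simp only [this, one_pow, Finset.sum_const, Finset.card_range, nsmul_eq_mul, mul_one]
      rw [inv_mul_cancel_left₀ hnC, pow_mul]
    simpa only [Function.comp_def, heq] using h
  · intro k hk
    have hk' : ω ^ k ≠ 1 := fun h1 => by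
      obtain ⟨l, rfl⟩ := (hω.pow_eq_one_iff_dvd k).mp h1
      exact hk ⟨l, rfl⟩
    rw [geom_sum_eq hk', ← pow_mul, mul_comm k n, pow_mul, hω.pow_eq_one, one_pow]
    simp

/-- Carathéodory's coefficient bound for functions with positive real part. -/
theorem ConvergesOnUnitBall.norm_coeff_le_two {A : PowerSeries ℂ} (hA : A.ConvergesOnUnitBall)
    (h0 : coeff 0 A = 1) (hre : ∀ z : ℂ, ‖z‖ < 1 → 0 < (A.leftEval z).re) {n : ℕ} (hn : n ≠ 0) :
    ‖coeff n A‖ ≤ 2 := by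
  have hω := Complex.isPrimitiveRoot_exp n hn
  set ω := Complex.exp (2 * Real.pi * Complex.I / n)
  have hω1 : ‖ω‖ = 1 := hω.norm'_eq_one hn
  have hroot : ∀ w : ℂ, ‖w‖ < 1 → ∃ z : ℂ, ‖z‖ < 1 ∧ z ^ n = w := by
    intro w hw
    obtain ⟨z, hz⟩ := IsAlgClosed.exists_pow_nat_eq w (Nat.pos_of_ne_zero hn)
    refine ⟨z, ?_, hz⟩
    rw [← hz, norm_pow] at hw
    exact (pow_lt_one_iff_of_nonneg (norm_nonneg z) hn).mp hw
  -- At `z ^ n` this series is the mean of `A` over the rotations of `z`, so it keeps the positive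
  -- real part, and its first coefficient is the `n`-th of `A`.
  have hB : (PowerSeries.mk fun k => coeff (n * k) A).ConvergesOnUnitBall := by
    refine convergesOnUnitBall_of_summable fun w hw => ?_
    obtain ⟨z, hz, rfl⟩ := hroot w hw
    simpa only [coeff_mk] using (hA.hasSum_coeff_mul hn hω hz).summable
  have h := hB.norm_coeff_one_le (by simpa using h0) fun w hw => by
    obtain ⟨z, hz, rfl⟩ := hroot w hw
    rw [leftEval_eq (by simpa only [coeff_mk] using hA.hasSum_coeff_mul hn hω hz)]
    have hn' : (n : ℂ)⁻¹ = (((n : ℝ)⁻¹ : ℝ) : ℂ) := by push_cast; rfl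
    rw [hn', Complex.re_ofReal_mul, Complex.re_sum]
    have hn0 : (0 : ℝ) < n := by exact_mod_cast Nat.pos_of_ne_zero hn
    refine mul_pos (inv_pos.mpr hn0) (Finset.sum_pos (fun j _ => hre _ ?_) ?_)
    · simpa [hω1] using hz
    · exact Finset.nonempty_range_iff.mpr hn
  simpa using h

end PowerSeries

/-! ### Carathéodory's bound over the quaternions and the regular quotient -/

namespace SliceRegular

/-- The complex coordinate of the orthogonal projection to the slice `ℂ_I`. -/
noncomputable def sliceProj (I q : ℍ[ℝ]) : ℂ := ⟨q.re, -(I * q).re⟩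

theorem abs_re_le_norm (q : ℍ[ℝ]) : |q.re| ≤ ‖q‖ := by
  refine abs_le_of_sq_le_sq ?_ (norm_nonneg q)
  rw [pow_two, pow_two, ← Quaternion.normSq_eq_norm_mul_self, Quaternion.normSq_def']
  nlinarith [sq_nonneg q.imI, sq_nonneg q.imJ, sq_nonneg q.imK]

theorem norm_sliceProj_le {I : ℍ[ℝ]} (hI : I ∈ imaginaryUnits) (q : ℍ[ℝ]) :
    ‖sliceProj I q‖ ≤ 2 * ‖q‖ := by
  refine (Complex.norm_le_abs_re_add_abs_im _).trans ?_
  have h1 := abs_re_le_norm q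
  have h2 := abs_re_le_norm (I * q)
  rw [norm_mul, norm_eq_one_of_mem hI, one_mul] at h2
  simp only [sliceProj, abs_neg]
  linarith

theorem re_sliceHom {I : ℍ[ℝ]} (hI : I ∈ imaginaryUnits) (z : ℂ) : (sliceHom hI z).re = z.re := by
  rw [← slicePoint_eq_sliceHom, slicePoint, Quaternion.coe_mul_eq_smul]
  simp [re_eq_zero_of_mem hI]

theorem sliceProj_sliceHom {I : ℍ[ℝ]} (hI : I ∈ imaginaryUnits) (z : ℂ) :
    sliceProj I (sliceHom hI z) = z := by
  have h : I * sliceHom hI z = sliceHom hI (Complex.I * z) := by rw [map_mul, sliceHom_I]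
  rw [sliceProj, h, re_sliceHom, re_sliceHom]
  apply Complex.ext <;> simp

/-- Left multiplication by `ℂ_I` preserves the orthogonal complement of `ℂ_I`, which has zero real
part. Projecting coefficients to the slice therefore keeps the real part of a power series on it. -/
theorem re_sliceHom_mul {I : ℍ[ℝ]} (hI : I ∈ imaginaryUnits) (z : ℂ) (q : ℍ[ℝ]) :
    (sliceHom hI z * q).re = (z * sliceProj I q).re := by
  rw [← slicePoint_eq_sliceHom, slicePoint, add_mul, mul_assoc, Quaternion.coe_mul_eq_smul,
    Quaternion.coe_mul_eq_smul, Quaternion.re_add, Quaternion.re_smul, Quaternion.re_smul,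
    Complex.mul_re]
  simp only [sliceProj]
  ring

theorem hasSum_re {u : ℕ → ℍ[ℝ]} {s : ℍ[ℝ]} (h : HasSum u s) :
    HasSum (fun n => (u n).re) s.re :=
  h.map (⟨⟨QuaternionAlgebra.re, rfl⟩, fun _ _ => rfl⟩ : ℍ[ℝ] →+ ℝ) Quaternion.continuous_re

open PowerSeries

/-- Carathéodory's coefficient bound over the quaternions. -/
theorem norm_coeff_le_two_of_re_pos {P : PowerSeries ℍ[ℝ]} (hP : P.ConvergesOnUnitBall)
    (h0 : coeff 0 P = 1) (hre : ∀ q : ℍ[ℝ], ‖q‖ < 1 → 0 < (P.leftEval q).re) {n : ℕ}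
    (hn : n ≠ 0) : ‖coeff n P‖ ≤ 2 := by
  -- The slice is chosen to contain the coefficient to be estimated, so the projection does not
  -- change it.
  set I := imUnit (coeff n P) with hIdef
  have hI : I ∈ imaginaryUnits := imUnit_mem _
  obtain ⟨w, hw⟩ : ∃ w, sliceHom hI w = coeff n P := ⟨_, sliceHom_re_add_norm_im _⟩
  set A : PowerSeries ℂ := PowerSeries.mk fun k => sliceProj I (coeff k P) with hA
  have hAc : A.ConvergesOnUnitBall := by
    intro r hr hr1
    refine Summable.of_nonneg_of_le (fun k => by positivity) (fun k => ?_)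
      ((hP r hr hr1).mul_left 2)
    rw [← mul_assoc, hA, coeff_mk]
    exact mul_le_mul_of_nonneg_right (norm_sliceProj_le hI _) (by positivity)
  have h := hAc.norm_coeff_le_two (by simp [hA, h0, sliceProj, re_eq_zero_of_mem hI]; rfl)
    (fun z hz => by
      have h1 := Complex.hasSum_re (hAc.hasSum hz)
      have h2 := hasSum_re (hP.hasSum (q := sliceHom hI z) (by rwa [norm_sliceHom]))
      simp only [← map_pow, re_sliceHom_mul] at h2
      simp only [hA, coeff_mk] at h1
      rw [h1.unique h2]
      exact hre _ (by rwa [norm_sliceHom])) hn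
  rwa [hA, coeff_mk, ← hw, sliceProj_sliceHom, ← norm_sliceHom hI, hw] at h

/-- The regular conjugate: conjugate all coefficients. -/
noncomputable def regularConj (A : PowerSeries ℍ[ℝ]) : PowerSeries ℍ[ℝ] :=
  PowerSeries.mk fun n => star (coeff n A)

theorem convergesOnUnitBall_regularConj {A : PowerSeries ℍ[ℝ]} (hA : A.ConvergesOnUnitBall) :
    (regularConj A).ConvergesOnUnitBall := by
  simpa [PowerSeries.ConvergesOnUnitBall, regularConj] using hA

theorem sliceHom_mul_eq {I : ℍ[ℝ]} (hI : I ∈ imaginaryUnits) (z : ℂ) (q : ℍ[ℝ]) :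
    sliceHom hI z * q = z.re • q + I * (z.im • q) := by
  rw [← slicePoint_eq_sliceHom, slicePoint, add_mul, mul_assoc, Quaternion.coe_mul_eq_smul,
    Quaternion.coe_mul_eq_smul, mul_smul_comm]

/-- On a sphere `x + y 𝕊` a power series is affine in the imaginary unit. -/
theorem exists_leftEval_sliceHom_eq {A : PowerSeries ℍ[ℝ]} (hA : A.ConvergesOnUnitBall) {z : ℂ}
    (hz : ‖z‖ < 1) : ∃ α β : ℍ[ℝ], ∀ (I : ℍ[ℝ]) (hI : I ∈ imaginaryUnits),
      A.leftEval (sliceHom hI z) = α + I * β ∧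
      (regularConj A).leftEval (sliceHom hI z) = star α + I * star β := by
  have hs := hA ‖z‖ (norm_nonneg z) hz
  have hre : Summable fun n => (z ^ n).re • coeff n A := by
    refine Summable.of_norm_bounded hs fun n => ?_
    rw [norm_smul, mul_comm, ← norm_pow]
    exact mul_le_mul_of_nonneg_left (Complex.abs_re_le_norm _) (norm_nonneg _)
  have him : Summable fun n => (z ^ n).im • coeff n A := by
    refine Summable.of_norm_bounded hs fun n => ?_
    rw [norm_smul, mul_comm, ← norm_pow]
    exact mul_le_mul_of_nonneg_left (Complex.abs_im_le_norm _) (norm_nonneg _)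
  refine ⟨∑' n, (z ^ n).re • coeff n A, ∑' n, (z ^ n).im • coeff n A,
    fun I hI => ⟨leftEval_eq ?_, leftEval_eq ?_⟩⟩
  · simpa only [← map_pow, sliceHom_mul_eq] using hre.hasSum.add (him.hasSum.mul_left I)
  · simpa only [← map_pow, sliceHom_mul_eq, regularConj, coeff_mk, Quaternion.star_smul]
      using hre.hasSum.star.add (him.hasSum.star.mul_left I)

/-- The regular conjugate of a zero-free power series is zero-free. -/
theorem leftEval_regularConj_ne_zero {A : PowerSeries ℍ[ℝ]} (hA : A.ConvergesOnUnitBall)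
    (h0 : ∀ q : ℍ[ℝ], ‖q‖ < 1 → A.leftEval q ≠ 0) {q : ℍ[ℝ]} (hq : ‖q‖ < 1) :
    (regularConj A).leftEval q ≠ 0 := by
  intro hzero
  obtain ⟨I, hI, z, rfl⟩ := exists_eq_sliceHom q
  rw [norm_sliceHom] at hq
  obtain ⟨α, β, h⟩ := exists_leftEval_sliceHom_eq hA hq
  rw [(h I hI).2] at hzero
  have hα : α = β * I := by
    have h1 := congrArg star hzero
    rw [star_add, star_mul, star_star, star_star, star_zero, star_eq_neg_of_mem hI, mul_neg,
      add_neg_eq_zero] at h1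
    exact h1
  by_cases hβ : β = 0
  · refine h0 _ (by rwa [norm_sliceHom]) ((h I hI).1.trans ?_)
    rw [hα, hβ]; simp
  · have hII : I * I = -1 := by rw [← pow_two]; exact hI
    -- A zero of the conjugate at `x + y I` forces `α = β I`; then `α + K β = 0` for this `K`, so
    -- the original series vanishes at `x + y K` on the same sphere.
    have hK : -(β * I * β⁻¹) ∈ imaginaryUnits := by
      change (-(β * I * β⁻¹)) ^ 2 = -1
      rw [neg_sq, pow_two]
      calc β * I * β⁻¹ * (β * I * β⁻¹) = β * (I * (β⁻¹ * β) * I) * β⁻¹ := by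
            simp only [mul_assoc]
        _ = -1 := by rw [inv_mul_cancel₀ hβ, mul_one, hII, mul_neg_one, neg_mul,
            mul_inv_cancel₀ hβ]
    refine h0 (sliceHom hK z) (by rwa [norm_sliceHom]) ((h _ hK).1.trans ?_)
    rw [hα, neg_mul, mul_assoc (β * I), inv_mul_cancel₀ hβ, mul_one, add_neg_cancel]

theorem commute_map_algebraMap (N : PowerSeries ℝ) (A : PowerSeries ℍ[ℝ]) :
    Commute (PowerSeries.map (algebraMap ℝ ℍ[ℝ]) N) A := by
  refine PowerSeries.ext fun n => ?_
  rw [coeff_mul, coeff_mul, ← Finset.Nat.sum_antidiagonal_swap]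
  refine Finset.sum_congr rfl fun p _ => ?_
  simp only [Prod.fst_swap, Prod.snd_swap, coeff_map]
  exact Algebra.commutes _ _

theorem exists_map_eq_regularConj_mul (A : PowerSeries ℍ[ℝ]) :
    ∃ N : PowerSeries ℝ, PowerSeries.map (algebraMap ℝ ℍ[ℝ]) N = regularConj A * A := by
  refine ⟨PowerSeries.mk fun n => (coeff n (regularConj A * A)).re, PowerSeries.ext fun n => ?_⟩
  rw [coeff_map, coeff_mk]
  refine (Quaternion.star_eq_self.mp ?_).symm
  rw [coeff_mul, star_sum, ← Finset.Nat.sum_antidiagonal_swap]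
  refine Finset.sum_congr rfl fun p _ => ?_
  simp [regularConj]

/-- With `Aᶜ` the regular conjugate, `Aᶜ A` has real coefficients and is central, so `(A Aᶜ) A = A
(Aᶜ A) = (Aᶜ A) A`, and `A` cancels because there are no zero divisors. -/
theorem mul_regularConj_eq {A : PowerSeries ℍ[ℝ]} (hA : A ≠ 0) :
    A * regularConj A = regularConj A * A := by
  obtain ⟨N, hN⟩ := exists_map_eq_regularConj_mul A
  have h : (A * regularConj A - regularConj A * A) * A = 0 := by
    rw [sub_mul, mul_assoc, ← hN, (commute_map_algebraMap N A).eq, sub_self]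
  exact sub_eq_zero.mp ((mul_eq_zero.mp h).resolve_right hA)

theorem convergesOnUnitBall_map_iff {R S : Type*} [NormedDivisionRing R] [NormedAlgebra ℝ R]
    [NormedDivisionRing S] [NormedAlgebra ℝ S] (N : PowerSeries ℝ) :
    (PowerSeries.map (algebraMap ℝ R) N).ConvergesOnUnitBall ↔
      (PowerSeries.map (algebraMap ℝ S) N).ConvergesOnUnitBall := by
  simp [PowerSeries.ConvergesOnUnitBall, norm_algebraMap']

theorem leftEval_map_sliceHom {N : PowerSeries ℝ}
    (hN : (PowerSeries.map (algebraMap ℝ ℂ) N).ConvergesOnUnitBall) {I : ℍ[ℝ]}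
    (hI : I ∈ imaginaryUnits) {z : ℂ} (hz : ‖z‖ < 1) :
    (PowerSeries.map (algebraMap ℝ ℍ[ℝ]) N).leftEval (sliceHom hI z) =
      sliceHom hI ((PowerSeries.map (algebraMap ℝ ℂ) N).leftEval z) := by
  refine leftEval_eq ?_
  have h := (hN.hasSum hz).map (sliceHom hI)
    (sliceHom hI).toLinearMap.continuous_of_finiteDimensional
  simpa [Function.comp_def] using h

/-- The left regular quotient of `G` by a zero-free `A` has positive real part if the pointwise
quotient has. -/
theorem exists_regularQuotient {A G : PowerSeries ℍ[ℝ]} (hA : A.ConvergesOnUnitBall)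
    (hG : G.ConvergesOnUnitBall) (h0 : ∀ q : ℍ[ℝ], ‖q‖ < 1 → A.leftEval q ≠ 0)
    (hre : ∀ q : ℍ[ℝ], ‖q‖ < 1 → 0 < ((A.leftEval q)⁻¹ * G.leftEval q).re) :
    ∃ P : PowerSeries ℍ[ℝ], P.ConvergesOnUnitBall ∧ A * P = G ∧
      ∀ q : ℍ[ℝ], ‖q‖ < 1 → 0 < (P.leftEval q).re := by
  have hA0 : A ≠ 0 := by
    rintro rfl
    exact h0 0 (by simp) (by simp [leftEval_zero])
  have hc := convergesOnUnitBall_regularConj hA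
  have hc0 : ∀ q : ℍ[ℝ], ‖q‖ < 1 → (regularConj A).leftEval q ≠ 0 := fun q hq =>
    leftEval_regularConj_ne_zero hA h0 hq
  -- Write `T q` for this conjugate of `q` by the value of the regular conjugate `Aᶜ` at `q`; it
  -- stays in the ball.
  have hT : ∀ q : ℍ[ℝ], ‖q‖ < 1 →
      ‖((regularConj A).leftEval q)⁻¹ * q * (regularConj A).leftEval q‖ < 1 := by
    intro q hq
    have := norm_ne_zero_iff.mpr (hc0 q hq)
    rw [norm_mul, norm_mul, norm_inv]
    field_simp
    exact hq
  obtain ⟨N, hN⟩ := exists_map_eq_regularConj_mul A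
  have hNH : (PowerSeries.map (algebraMap ℝ ℍ[ℝ]) N).ConvergesOnUnitBall := by
    rw [hN]; exact hc.mul hA
  have hNC := (convergesOnUnitBall_map_iff (R := ℍ[ℝ]) (S := ℂ) N).mp hNH
  have hN0 : ∀ q : ℍ[ℝ], ‖q‖ < 1 → (PowerSeries.map (algebraMap ℝ ℍ[ℝ]) N).leftEval q ≠ 0 := by
    intro q hq
    rw [hN, leftEval_mul_of_ne_zero hc hA hq (hc0 q hq)]
    exact mul_ne_zero (hc0 q hq) (h0 _ (hT q hq))
  have hNC0 : ∀ z : ℂ, ‖z‖ < 1 → (PowerSeries.map (algebraMap ℝ ℂ) N).leftEval z ≠ 0 := by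
    intro z hz hz0
    refine hN0 (sliceHom (imUnit_mem 0) z) (by rwa [norm_sliceHom]) ?_
    rw [leftEval_map_sliceHom hNC _ hz, hz0, map_zero]
  -- Convergence of the formal inverse `N⁻¹` is obtained over `ℂ`, where a zero-free sum has a
  -- holomorphic reciprocal. It passes to `ℍ` because the coefficients are real.
  obtain ⟨B, hB, hNB⟩ := hNC.exists_mul_eq_one hNC0
  have hNinv : N * N⁻¹ = 1 := by
    refine PowerSeries.mul_inv_cancel N fun h => hNC0 0 (by simp) ?_
    rw [leftEval_zero, coeff_map, coeff_zero_eq_constantCoeff_apply, h, map_zero]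
  have hBeq : B = PowerSeries.map (algebraMap ℝ ℂ) N⁻¹ := by
    refine left_inv_eq_right_inv (a := PowerSeries.map (algebraMap ℝ ℂ) N) ?_ ?_
    · rw [mul_comm, hNB]
    · rw [← map_mul, hNinv, map_one]
  set M := PowerSeries.map (algebraMap ℝ ℍ[ℝ]) N⁻¹ with hM
  have hMc : M.ConvergesOnUnitBall := by
    rw [hM, convergesOnUnitBall_map_iff (S := ℂ), ← hBeq]; exact hB
  have hNM : PowerSeries.map (algebraMap ℝ ℍ[ℝ]) N * M = 1 := by
    rw [hM, ← map_mul, hNinv, map_one]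
  have hPc : (M * (regularConj A * G)).ConvergesOnUnitBall := hMc.mul (hc.mul hG)
  -- `P = N⁻¹ Aᶜ G` with `N = Aᶜ A = A Aᶜ` central, so `A P = G`.
  refine ⟨M * (regularConj A * G), hPc, ?_, fun q hq => ?_⟩
  · rw [← mul_assoc, ← (commute_map_algebraMap N⁻¹ A).eq, mul_assoc, ← mul_assoc A,
      mul_regularConj_eq hA0, ← hN, ← mul_assoc, (commute_map_algebraMap N⁻¹ _).eq, hNM, one_mul]
  · have hcomm : Commute q ((PowerSeries.map (algebraMap ℝ ℍ[ℝ]) N).leftEval q) := by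
      obtain ⟨I, hI, z, rfl⟩ := exists_eq_sliceHom q
      rw [leftEval_map_sliceHom hNC hI (by rwa [norm_sliceHom] at hq)]
      exact (Commute.all _ _).map (sliceHom hI)
    -- Evaluating `N P = Aᶜ G` and `N = Aᶜ A` at `q` gives `Aᶜ(q) A(T q) P(q) = Aᶜ(q) G(T q)`, hence
    -- `P(q) = A(T q)⁻¹ G(T q)`.
    have h1 := leftEval_mul_of_commute hNH hPc hq hcomm
    rw [← mul_assoc, hNM, one_mul, leftEval_mul_of_ne_zero hc hG hq (hc0 q hq), hN,
      leftEval_mul_of_ne_zero hc hA hq (hc0 q hq), mul_assoc ((regularConj A).leftEval q)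
        (A.leftEval _)] at h1
    have h2 := mul_left_cancel₀ (hc0 q hq) h1
    have h3 := hre _ (hT q hq)
    rwa [h2, inv_mul_cancel_left₀ (h0 _ (hT q hq))] at h3

end SliceRegular

/-! ### Coefficient bounds for slice starlike and slice close-to-convex functions -/

namespace SliceRegular

open PowerSeries

/-- The power series `∑ q ^ n * (n + 1) a n`, the derivative of `∑ q ^ (n + 1) * a n`. -/
noncomputable def derivMulX (A : PowerSeries ℍ[ℝ]) : PowerSeries ℍ[ℝ] :=
  PowerSeries.mk fun n : ℕ => ((n : ℝ) + 1) • coeff n A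

theorem summable_zero_pow_mul (a : ℕ → ℍ[ℝ]) : Summable fun n => (0 : ℍ[ℝ]) ^ n * a n :=
  summable_of_ne_finset_zero (s := {0}) fun n hn => by simp [by simpa using hn]

/-- A normalized slice regular function is `q * A(q)` for a power series `A` with `A(0) = 1`. -/
theorem IsSliceRegularOn.exists_normalized {f : ℍ[ℝ] → ℍ[ℝ]} (hf : IsSliceRegularOn f unitBall)
    (h0 : f 0 = 0) (h1 : sliceDeriv f 0 = 1) : ∃ A : PowerSeries ℍ[ℝ],
      A.ConvergesOnUnitBall ∧ (derivMulX A).ConvergesOnUnitBall ∧ coeff 0 A = 1 ∧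
      ∀ q : ℍ[ℝ], ‖q‖ < 1 → f q = q * A.leftEval q ∧ sliceDeriv f q = (derivMulX A).leftEval q := by
  obtain ⟨B, hB⟩ := hf.exists_powerSeries
  have hB0 : coeff 0 B = 0 := by
    rw [← leftEval_zero, leftEval_eq (hB 0 (by simp)).1, h0]
  set A : PowerSeries ℍ[ℝ] := PowerSeries.mk fun n => coeff (n + 1) B with hA
  have hD : ∀ q : ℍ[ℝ], ‖q‖ < 1 →
      HasSum (fun n => q ^ n * coeff n (derivMulX A)) (sliceDeriv f q) := by
    intro q hq
    simpa only [derivMulX, hA, coeff_mk] using (hB q hq).2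
  have hf' : ∀ q : ℍ[ℝ], ‖q‖ < 1 → HasSum (fun n => q * (q ^ n * coeff n A)) (f q) := by
    intro q hq
    have h := (hasSum_nat_add_iff' 1).mpr (hB q hq).1
    simpa [hB0, hA, pow_succ', mul_assoc] using h
  have hs : ∀ q : ℍ[ℝ], ‖q‖ < 1 → Summable fun n => q ^ n * coeff n A := by
    intro q hq
    -- The factor `q` cannot be cancelled at `q = 0`, where summability is trivial.
    rcases eq_or_ne q 0 with rfl | hq0
    · exact summable_zero_pow_mul _
    · exact (summable_mul_left_iff hq0).mp (hf' q hq).summable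
  have hDc : (derivMulX A).ConvergesOnUnitBall :=
    convergesOnUnitBall_of_summable fun q hq => (hD q hq).summable
  refine ⟨A, convergesOnUnitBall_of_summable hs, hDc, ?_, fun q hq =>
    ⟨(hf' q hq).unique ((hs q hq).hasSum.mul_left q), (leftEval_eq (hD q hq)).symm⟩⟩
  have := leftEval_eq (hD 0 (by simp))
  rw [leftEval_zero, h1] at this
  simpa [derivMulX] using this

/-- The coefficient recursion of a normalized slice regular function whose slice derivative is
controlled by a slice starlike function. -/
theorem IsSliceStarlike.exists_coeff_eq {g h : ℍ[ℝ] → ℍ[ℝ]} (hh : IsSliceStarlike h)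
    {A B : PowerSeries ℍ[ℝ]} (hA : A.ConvergesOnUnitBall) (hA0 : coeff 0 A = 1)
    (hAh : ∀ q : ℍ[ℝ], ‖q‖ < 1 → h q = q * A.leftEval q)
    (hB : (derivMulX B).ConvergesOnUnitBall) (hB0 : coeff 0 B = 1)
    (hBg : ∀ q : ℍ[ℝ], ‖q‖ < 1 → sliceDeriv g q = (derivMulX B).leftEval q)
    (hre : ∀ q ∈ unitBall, q ≠ 0 → 0 < ((h q)⁻¹ * q * sliceDeriv g q).re) :
    ∃ c : ℕ → ℍ[ℝ], c 0 = 1 ∧ (∀ n ≠ 0, ‖c n‖ ≤ 2) ∧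
      ∀ n : ℕ, ((n : ℝ) + 1) • coeff n B =
        ∑ i ∈ Finset.range n, coeff i A * c (n - i) + coeff n A := by
  have hne : ∀ q : ℍ[ℝ], ‖q‖ < 1 → A.leftEval q ≠ 0 := by
    intro q hq hz
    rcases eq_or_ne q 0 with rfl | hq0
    · rw [leftEval_zero, hA0] at hz
      exact one_ne_zero hz
    · exact hq0 (hh.zeros q (mem_unitBall.mpr hq) (by rw [hAh q hq, hz, mul_zero]))
  obtain ⟨P, hP, hAP, hPre⟩ := exists_regularQuotient hA hB hne fun q hq => by
    rcases eq_or_ne q 0 with rfl | hq0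
    · simp [leftEval_zero, hA0, derivMulX, hB0]
    · have := hre q (mem_unitBall.mpr hq) hq0
      rwa [hAh q hq, hBg q hq, mul_inv_rev, inv_mul_cancel_right₀ hq0] at this
  have hP0 : coeff 0 P = 1 := by
    have := congrArg (coeff 0) hAP
    simpa [coeff_mul, hA0, derivMulX, hB0] using this
  refine ⟨fun n => coeff n P, hP0, fun n hn => norm_coeff_le_two_of_re_pos hP hP0 hPre hn,
    fun n => ?_⟩
  have := congrArg (coeff n) hAP
  rw [coeff_mul, Finset.Nat.sum_antidiagonal_eq_sum_range_succ_mk, Finset.sum_range_succ] at this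
  simpa [derivMulX, hP0] using this.symm

theorem norm_sum_range_mul_le {a c : ℕ → ℍ[ℝ]} {n : ℕ}
    (ha : ∀ i < n, ‖a i‖ ≤ i + 1) (hc : ∀ i ≠ 0, ‖c i‖ ≤ 2) :
    ‖∑ i ∈ Finset.range n, a i * c (n - i)‖ ≤ n * (n + 1) := by
  have hsum : ∑ i ∈ Finset.range n, ((i : ℝ) + 1) * 2 = n * (n + 1) := by
    induction n with
    | zero => simp
    | succ n ih =>
      rw [Finset.sum_range_succ, ih fun i hi => ha i (hi.trans n.lt_succ_self)]
      push_cast; ring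
  rw [← hsum]
  refine (norm_sum_le _ _).trans (Finset.sum_le_sum fun i hi => ?_)
  have hi' := Finset.mem_range.mp hi
  rw [norm_mul]
  exact mul_le_mul (ha i hi') (hc _ (Nat.sub_pos_of_lt hi').ne') (norm_nonneg _) (by positivity)

/-- The Bieberbach bound for a slice starlike function `q * A(q)`. -/
theorem IsSliceStarlike.norm_coeff_le {h : ℍ[ℝ] → ℍ[ℝ]} (hh : IsSliceStarlike h)
    {A : PowerSeries ℍ[ℝ]} (hA : A.ConvergesOnUnitBall) (hA0 : coeff 0 A = 1)
    (hAh : ∀ q : ℍ[ℝ], ‖q‖ < 1 → h q = q * A.leftEval q)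
    (hD : (derivMulX A).ConvergesOnUnitBall)
    (hDh : ∀ q : ℍ[ℝ], ‖q‖ < 1 → sliceDeriv h q = (derivMulX A).leftEval q) (n : ℕ) :
    ‖coeff n A‖ ≤ n + 1 := by
  obtain ⟨c, -, hc2, hc⟩ := hh.exists_coeff_eq hA hA0 hAh hD hA0 hDh hh.re_pos
  induction n using Nat.strong_induction_on with
  | _ n ih =>
    rcases Nat.eq_zero_or_pos n with rfl | hn
    · simp [hA0]
    · have hn' : (0 : ℝ) < n := by exact_mod_cast hn
      -- Here both series are `A`, so the last term of the recursion cancels one copy of `coeff n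
      -- A`, and only smaller indices remain on the right.
      have h1 : (n : ℝ) • coeff n A = ∑ i ∈ Finset.range n, coeff i A * c (n - i) := by
        have := hc n
        rw [add_smul, one_smul] at this
        exact add_right_cancel this
      have h2 := norm_sum_range_mul_le (a := fun i => coeff i A) ih hc2
      rw [← h1, norm_smul, Real.norm_of_nonneg hn'.le] at h2
      exact le_of_mul_le_mul_left h2 hn'

/-- The Bieberbach bound for slice close-to-convex functions. -/
theorem IsSliceCloseToConvex.exists_coeff_bound {f : ℍ[ℝ] → ℍ[ℝ]} (hf : IsSliceCloseToConvex f) :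
    ∃ B : PowerSeries ℍ[ℝ], B.ConvergesOnUnitBall ∧
      (∀ q : ℍ[ℝ], ‖q‖ < 1 → f q = q * B.leftEval q) ∧
      coeff 0 B = 1 ∧ ∀ n : ℕ, ‖coeff n B‖ ≤ n + 1 := by
  obtain ⟨h, hh, hre⟩ := hf.exists_starlike
  obtain ⟨A, hA, hDA, hA0, hAh⟩ := hh.regular.exists_normalized hh.map_zero hh.deriv_zero
  obtain ⟨B, hB, hDB, hB0, hBf⟩ := hf.regular.exists_normalized hf.map_zero hf.deriv_zero
  refine ⟨B, hB, fun q hq => (hBf q hq).1, hB0, fun n => ?_⟩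
  have hAn := hh.norm_coeff_le hA hA0 (fun q hq => (hAh q hq).1) hDA (fun q hq => (hAh q hq).2)
  obtain ⟨c, -, hc2, hc⟩ := hh.exists_coeff_eq hA hA0 (fun q hq => (hAh q hq).1) hDB hB0
    (fun q hq => (hBf q hq).2) hre
  have h1 := (norm_add_le _ _).trans
    (add_le_add (norm_sum_range_mul_le (n := n) (a := fun i => coeff i A) (fun i _ => hAn i) hc2)
      (hAn n))
  have hn : (0 : ℝ) < n + 1 := by positivity
  rw [← hc n, norm_smul, Real.norm_of_nonneg hn.le] at h1
  refine le_of_mul_le_mul_left (h1.trans (le_of_eq ?_)) hn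
  ring

theorem IsSliceCloseToConvex.norm_expansion_le {f : ℍ[ℝ] → ℍ[ℝ]} (hf : IsSliceCloseToConvex f)
    {p : ℕ → ℍ[ℝ]} (hp : HasNormalizedExpansion f p) (k : ℕ) : ‖p (k + 2)‖ ≤ k + 2 := by
  obtain ⟨B, hB, hBf, hB0, hBn⟩ := hf.exists_coeff_bound
  have hmem : ∀ t : ℝ, |t| < 1 → ‖(t : ℍ[ℝ])‖ < 1 := fun t ht => by
    rwa [Quaternion.norm_coe, Real.norm_eq_abs]
  -- Both expansions of `f` are compared on the real axis: `0, b_0, b_1, …` against `0, 1, p_2, p_3,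
  -- …`, where `0` and `1` replace the unused `p 0` and `p 1`.
  have heq := eq_of_hasSum_pow_smul (s := fun t : ℝ => f t)
    (a := fun n => Nat.casesOn n 0 fun n => coeff n B)
    (b := fun n => Nat.casesOn n 0 fun n => Nat.casesOn n 1 fun n => p (n + 2)) ?_ ?_
  · have h := congrFun heq (k + 2)
    have h' : coeff (k + 1) B = p (k + 2) := h
    rw [← h']
    refine (hBn _).trans (le_of_eq ?_)
    push_cast; ring
  · intro t ht
    rw [← hasSum_nat_add_iff' 1]
    have h := (hB.hasSum (hmem t ht)).mul_left (t : ℍ[ℝ])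
    rw [← hBf _ (hmem t ht)] at h
    simp only [← Quaternion.coe_pow, Quaternion.coe_mul_eq_smul, smul_smul, ← pow_succ'] at h
    rw [Finset.sum_range_one, show t ^ 0 • (Nat.casesOn 0 0 fun n => coeff n B : ℍ[ℝ]) = 0 from
      smul_zero _, sub_zero]
    exact h
  · intro t ht
    rw [← hasSum_nat_add_iff' 2]
    have h := hp _ (mem_unitBall.mpr (hmem t ht))
    simp only [← Quaternion.coe_pow, Quaternion.coe_mul_eq_smul] at h
    have hs : ∑ i ∈ Finset.range 2, t ^ i •
        (Nat.casesOn i 0 fun n => Nat.casesOn n 1 fun n => p (n + 2) : ℍ[ℝ]) = (t : ℍ[ℝ]) := by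
      rw [Finset.sum_range_succ, Finset.sum_range_one]
      change t ^ 0 • (0 : ℍ[ℝ]) + t ^ 1 • (1 : ℍ[ℝ]) = _
      rw [smul_zero, zero_add, pow_one, ← Quaternion.coe_mul_eq_smul, mul_one]
    rw [hs]
    exact h

/-! ### The radius and the extremal Koebe function -/

theorem hasSum_add_two_mul_pow {r : ℝ} (hr0 : 0 ≤ r) (hr : r < 1) :
    HasSum (fun k : ℕ => ((k : ℝ) + 2) * r ^ (k + 2)) (r / (1 - r) ^ 2 - r) := by
  have h := (hasSum_nat_add_iff' 2).mpr
    (hasSum_coe_mul_geometric_of_norm_lt_one (r := r) (by rwa [Real.norm_of_nonneg hr0]))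
  simpa [Finset.sum_range_succ] using h

theorem sqrt_five_bounds : 2 < √5 ∧ √5 < 3 := by
  constructor
  · rw [Real.lt_sqrt] <;> norm_num
  · rw [Real.sqrt_lt'] <;> norm_num

/-- `(3 - √5)/2` is the smaller root of `r² - 3r + 1 = (1 - r)² - r`. -/
theorem koebe_le_one {r : ℝ} (hr : r ≤ (3 - √5) / 2) : r / (1 - r) ^ 2 ≤ 1 := by
  have h5 := Real.sq_sqrt (show (0 : ℝ) ≤ 5 by norm_num)
  obtain ⟨h2, h3⟩ := sqrt_five_bounds
  rw [div_le_one (by apply pow_pos; linarith)]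
  nlinarith

theorem one_lt_koebe {r : ℝ} (hr : (3 - √5) / 2 < r) (hr1 : r < 1) : 1 < r / (1 - r) ^ 2 := by
  have h5 := Real.sq_sqrt (show (0 : ℝ) ≤ 5 by norm_num)
  obtain ⟨h2, h3⟩ := sqrt_five_bounds
  rw [one_lt_div (by apply pow_pos; linarith)]
  nlinarith

/-- When `f` acts on every slice as one holomorphic `F`, the slice equation is the Cauchy–Riemann
equation of `F`. This reduces the Koebe function to complex calculus. -/
theorem isSliceRegularOn_of_slicewise {f : ℍ[ℝ] → ℍ[ℝ]} {F : ℂ → ℂ}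
    (hF : DifferentiableOn ℂ F (Metric.ball 0 1))
    (hfF : ∀ (I : ℍ[ℝ]) (hI : I ∈ imaginaryUnits) (z : ℂ), f (sliceHom hI z) = sliceHom hI (F z)) :
    IsSliceRegularOn f unitBall ∧ ∀ (I : ℍ[ℝ]) (hI : I ∈ imaginaryUnits) (z : ℂ), ‖z‖ < 1 →
      sliceDeriv f (sliceHom hI z) = sliceHom hI (deriv F z) := by
  have hder : ∀ z : ℂ, ‖z‖ < 1 → HasDerivAt F (deriv F z) z := fun z hz =>
    (hF.differentiableAt (Metric.isOpen_ball.mem_nhds (by simpa using hz))).hasDerivAt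
  have key : ∀ (I : ℍ[ℝ]) (hI : I ∈ imaginaryUnits) (z : ℂ), ‖z‖ < 1 →
      partialX I f z.re z.im = sliceHom hI (deriv F z) ∧
      partialY I f z.re z.im = I * sliceHom hI (deriv F z) := by
    intro I hI z hz
    let φ : ℂ →L[ℝ] ℍ[ℝ] := LinearMap.toContinuousLinearMap (sliceHom hI).toLinearMap
    have hpt : ∀ x y : ℝ, f (slicePoint I x y) = φ (F ⟨x, y⟩) := fun x y => by
      rw [← show _ = slicePoint I x y from (slicePoint_eq_sliceHom hI ⟨x, y⟩).symm]
      exact hfF I hI _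
    constructor
    · have h := φ.hasFDerivAt.comp_hasDerivAt z.re
        ((hder z hz).scomp_of_eq z.re (hasDerivAt_complexMk_left z.re z.im) rfl)
      simp only [partialX, hpt]
      refine h.deriv.trans ?_
      simp [φ]
    · have h := φ.hasFDerivAt.comp_hasDerivAt z.im
        ((hder z hz).scomp_of_eq z.im (hasDerivAt_complexMk_right z.re z.im) rfl)
      simp only [partialY, hpt]
      refine h.deriv.trans ?_
      simp [φ, sliceHom_I]
  have hII : ∀ I ∈ imaginaryUnits, I * I = -1 := fun I hI => by rw [← pow_two]; exact hI
  have hlt : ∀ (I : ℍ[ℝ]) (hI : I ∈ imaginaryUnits) (x y : ℝ), slicePoint I x y ∈ unitBall →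
      ‖(⟨x, y⟩ : ℂ)‖ < 1 := by
    intro I hI x y h
    rw [← norm_sliceHom hI, ← slicePoint_eq_sliceHom]
    exact mem_unitBall.mp h
  have hreg : IsSliceRegularOn f unitBall := by
    intro I hI
    constructor
    · rw [setOf_slicePoint_mem_unitBall hI]
      simp only [slicePoint_eq_sliceHom hI, hfF I hI]
      have h1 : ContDiffOn ℝ 1 F (Metric.ball 0 1) :=
        (hF.contDiffOn Metric.isOpen_ball).restrict_scalars ℝ
      exact (LinearMap.toContinuousLinearMap (sliceHom hI).toLinearMap).contDiff.comp_contDiffOn h1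
    · intro x y hxy
      obtain ⟨h1, h2⟩ := key I hI ⟨x, y⟩ (hlt I hI x y hxy)
      rw [h1, h2, ← mul_assoc, hII I hI]
      simp
  refine ⟨hreg, fun I hI z hz => ?_⟩
  obtain ⟨h1, h2⟩ := key I hI z hz
  rw [← slicePoint_eq_sliceHom, sliceDeriv_slicePoint hreg hI, sliceDerivAlong, h1, h2, ← mul_assoc,
    hII I hI, neg_one_mul, sub_neg_eq_add, ← two_smul ℝ, smul_smul]
  · norm_num
  · rw [slicePoint_eq_sliceHom hI, mem_unitBall, norm_sliceHom]; exact hz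

/-- The Koebe function. -/
noncomputable def koebe {R : Type*} [DivisionRing R] (q : R) : R := q / (1 - q) ^ 2

theorem koebe_sliceHom {I : ℍ[ℝ]} (hI : I ∈ imaginaryUnits) (z : ℂ) :
    koebe (sliceHom hI z) = sliceHom hI (koebe z) := by
  simp [koebe]

theorem one_sub_ne_zero_of_norm_lt_one {z : ℂ} (hz : ‖z‖ < 1) : 1 - z ≠ 0 := by
  rintro h
  rw [← sub_eq_zero.mp h] at hz
  simp at hz

theorem hasDerivAt_koebe {z : ℂ} (hz : ‖z‖ < 1) :
    HasDerivAt (koebe : ℂ → ℂ) ((1 + z) / (1 - z) ^ 3) z := by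
  have h0 := one_sub_ne_zero_of_norm_lt_one hz
  have h := (hasDerivAt_id z).div (((hasDerivAt_id z).const_sub 1).pow 2) (pow_ne_zero 2 h0)
  refine h.congr_deriv ?_
  simp only [id, Pi.pow_apply]
  field_simp
  ring

theorem isSliceStarlike_koebe : IsSliceStarlike koebe := by
  obtain ⟨hreg, hder⟩ := isSliceRegularOn_of_slicewise (f := koebe) (F := koebe)
    (fun z hz => (hasDerivAt_koebe (by simpa using hz)).differentiableAt.differentiableWithinAt)
    fun I hI z => koebe_sliceHom hI z
  refine ⟨⟨hreg, by simp [koebe], ?_, ?_⟩, ?_⟩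
  · have h := hder _ (imUnit_mem 0) 0 (by simp)
    rw [map_zero, (hasDerivAt_koebe (by simp)).deriv] at h
    simpa using h
  · intro q hq h
    have h1 : (1 : ℍ[ℝ]) - q ≠ 0 := by
      intro h1
      rw [mem_unitBall, ← sub_eq_zero.mp h1] at hq
      simp at hq
    exact (div_eq_zero_iff.mp h).resolve_right (pow_ne_zero 2 h1)
  · intro q hq hq0
    obtain ⟨I, hI, z, rfl⟩ := exists_eq_sliceHom q
    rw [mem_unitBall, norm_sliceHom] at hq
    have hz0 : z ≠ 0 := by rintro rfl; exact hq0 (map_zero _)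
    have h1 := one_sub_ne_zero_of_norm_lt_one hq
    rw [hder I hI z hq, koebe_sliceHom, (hasDerivAt_koebe hq).deriv, ← map_inv₀, ← map_mul,
      ← map_mul, re_sliceHom]
    -- The Cayley transform, which maps the disc to the right half-plane: its real part is `(1 -
    -- |z|²) / |1 - z|²`.
    have : (koebe z)⁻¹ * z * ((1 + z) / (1 - z) ^ 3) = (1 + z) / (1 - z) := by
      rw [koebe]; field_simp
    rw [this, Complex.div_re, ← add_div]
    refine div_pos ?_ (Complex.normSq_pos.mpr h1)
    have h2 : z.re * z.re + z.im * z.im < 1 := by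
      rw [← Complex.normSq_apply, Complex.normSq_eq_norm_sq]
      exact pow_lt_one₀ (norm_nonneg _) hq two_ne_zero
    simp
    nlinarith

theorem isSliceCloseToConvex_koebe : IsSliceCloseToConvex koebe :=
  ⟨isSliceStarlike_koebe.regular, isSliceStarlike_koebe.map_zero, isSliceStarlike_koebe.deriv_zero,
    koebe, isSliceStarlike_koebe, isSliceStarlike_koebe.re_pos⟩

theorem natCast_mul_pow_eq (q : ℍ[ℝ]) (k : ℕ) :
    (k : ℍ[ℝ]) * q ^ k = q ^ k * ((k : ℝ) : ℍ[ℝ]) := by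
  rw [Quaternion.coe_natCast]
  exact Nat.cast_commute _ _

theorem hasSum_koebe_sub {q : ℍ[ℝ]} (hq : ‖q‖ < 1) :
    HasSum (fun k : ℕ => q ^ (k + 2) * (((k + 2 : ℕ) : ℝ) : ℍ[ℝ])) (koebe q - q) := by
  have h := hasSum_coe_mul_geometric_of_norm_lt_one hq
  simp only [natCast_mul_pow_eq] at h
  have h := (hasSum_nat_add_iff' 2).mpr h
  rw [Finset.sum_range_succ, Finset.sum_range_one] at h
  simp only [Nat.cast_zero, Nat.cast_one, Quaternion.coe_zero, Quaternion.coe_one, mul_zero,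
    zero_add, mul_one, pow_one] at h
  exact h

theorem hasNormalizedExpansion_koebe :
    HasNormalizedExpansion koebe fun k => ((k : ℝ) : ℍ[ℝ]) :=
  fun _ hq => hasSum_koebe_sub (mem_unitBall.mp hq)

end SliceRegular

theorem theorem1p3 :
    (∀ (f : ℍ[ℝ] → ℍ[ℝ]) (p : ℕ → ℍ[ℝ]),
      SliceRegular.IsSliceCloseToConvex f → SliceRegular.HasNormalizedExpansion f p →
      ∀ q : ℍ[ℝ], ‖q‖ ≤ (3 - Real.sqrt 5) / 2 →
        Summable (fun k : ℕ => ‖q ^ (k + 2) * p (k + 2)‖) ∧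
        ‖q‖ + ∑' k : ℕ, ‖q ^ (k + 2) * p (k + 2)‖ ≤ 1) ∧
    (∃ (f : ℍ[ℝ] → ℍ[ℝ]) (p : ℕ → ℍ[ℝ]),
      SliceRegular.IsSliceCloseToConvex f ∧ SliceRegular.HasNormalizedExpansion f p ∧
      ∀ q : ℍ[ℝ], (3 - Real.sqrt 5) / 2 < ‖q‖ → ‖q‖ < 1 →
        Summable (fun k : ℕ => ‖q ^ (k + 2) * p (k + 2)‖) ∧
        1 < ‖q‖ + ∑' k : ℕ, ‖q ^ (k + 2) * p (k + 2)‖) := by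

  constructor
  · intro f p hf hp q hq
    have hq1 : ‖q‖ < 1 := by
      have := SliceRegular.sqrt_five_bounds.1
      linarith
    have hs := SliceRegular.hasSum_add_two_mul_pow (norm_nonneg q) hq1
    have hle : ∀ k : ℕ, ‖q ^ (k + 2) * p (k + 2)‖ ≤ ((k : ℝ) + 2) * ‖q‖ ^ (k + 2) := by
      intro k
      rw [norm_mul, norm_pow, mul_comm]
      exact mul_le_mul_of_nonneg_right (hf.norm_expansion_le hp k) (by positivity)
    have hsum := Summable.of_nonneg_of_le (fun k => norm_nonneg _) hle hs.summable
    refine ⟨hsum, ?_⟩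
    have h1 := hsum.tsum_le_tsum hle hs.summable
    rw [hs.tsum_eq] at h1
    have h2 := SliceRegular.koebe_le_one hq
    linarith
  · refine ⟨SliceRegular.koebe, fun k => ((k : ℝ) : ℍ[ℝ]), SliceRegular.isSliceCloseToConvex_koebe,
      SliceRegular.hasNormalizedExpansion_koebe, fun q hq hq1 => ?_⟩
    have hs := SliceRegular.hasSum_add_two_mul_pow (norm_nonneg q) hq1
    have heq : ∀ k : ℕ, ‖q ^ (k + 2) * (((k + 2 : ℕ) : ℝ) : ℍ[ℝ])‖ =
        ((k : ℝ) + 2) * ‖q‖ ^ (k + 2) := by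
      intro k
      rw [norm_mul, norm_pow, mul_comm, Quaternion.norm_coe,
        Real.norm_of_nonneg (by positivity)]
      push_cast; rfl
    simp only [heq]
    refine ⟨hs.summable, ?_⟩
    rw [hs.tsum_eq]
    have := SliceRegular.one_lt_koebe hq hq1
    linarith
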